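/- For $n\ge 2$ let $\xi^{(n)}=(\xi^{(n)}_{ij})_{1\le i,j\le n}$ be i.i.d. Bernoulli random variables of parameter $p_n\in(0,1]$ (the joint law of the graphs for different $n$ being arbitrary), and let $(\theta_0^{1,n},\dots,\theta_0^{n,n})_{n}$ be random variables with values in the torus $\mathbb T=\mathbb R/2\pi\mathbb Z$. Let $\mathbb P$ be the joint law of the graph sequence and of the initial conditions, with marginals $\mathbb P_g$ (graphs) and $\mathbb P_0$ (initial conditions), and suppose that they are independent: $\mathbb P=\mathbb P_g\otimes\mathbb P_0$. Let $\mathbb E_0$ be the expectation over the initial conditions for a frozen graph sequence, i.e. the expectation under $\mathbb P_0$. For $r>1$ let $H^{-r}(\mathbb T^2)$, with norm $\|\cdot\|_{-r}$, be the dual of the Sobolev space $H^r(\mathbb T^2)$ with norm $\|f\|_r^2=\sum_{k\in\mathbb Z^2}(1+|k|^2)^r|\hat f(k)|^2$, and let $$\hat\eta_0^n=\sqrt n\,\frac1{n^2}\sum_{i,j=1}^n\Big(\frac{\xi^{(n)}_{ij}}{p_n}-1\Big)\,\delta_{\theta_0^{i,n}}\otimes\delta_{\theta_0^{j,n}}\in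 H^{-r}(\mathbb T^2).$$ Suppose that $\liminf_n p_n^3n^{1-\varepsilon}=\infty$ for some $\varepsilon\in(0,1)$. Then: 1. for every $r>1$, $\ \lim_{n\to\infty}\mathbb E_0\big[\|\hat\eta_0^n\|_{-r}^2\big]=0$, $\mathbb P_g$-almost surely; 2. for every $r_0>3$ and every $\alpha\in(0,1)$, $\ \sup_{n\ge2}\mathbb E_0\big[\|\hat\eta_0^n\|_{-r_0}^{1+\alpha}\big]<\infty$, $\mathbb P_g$-almost surely; 3. for every $r_1>5$, $\mathbb P_g$-almost surely, $\hat\eta_0^n$ converges in law under $\mathbb P_0$, as $n\to\infty$, in $H^{-r_1}(\mathbb T^2)$ to $\hat\eta_0\equiv0$. -/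

import Mathlib

open MeasureTheory ProbabilityTheory Filter Topology
open scoped ENNReal

noncomputable section

/-- The period of the torus is positive. -/
instance twoPiPos : Fact (0 < 2 * Real.pi) := Fact.mk Real.two_pi_pos

/-- The one-dimensional torus `ℝ / 2πℤ`. -/
abbrev Torus : Type := AddCircle (2 * Real.pi)

/-! ### Sobolev spaces on the two-dimensional torus -/

/-- The Fourier coefficient of index `k = (k₁, k₂)` of a function on the two-dimensional torus,
`(2π)⁻² ∫∫ f(x, y) e^{-i (k₁ x + k₂ y)} dx dy`. -/
def torusCoeff (f : Torus × Torus → ℂ) (k : ℤ × ℤ) : ℂ :=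
  fourierCoeff (fun x => fourierCoeff (fun y => f (x, y)) k.2) k.1

/-- The Fourier multiplier `1 + |k|²` of `1 - Δ`. -/
def japSq (k : ℤ × ℤ) : ℝ := 1 + (k.1 : ℝ) ^ 2 + (k.2 : ℝ) ^ 2

theorem japSq_pos (k : ℤ × ℤ) : 0 < japSq k := by
  unfold japSq; positivity

theorem japSq_rpow_mul_sq (r : ℝ) (k : ℤ × ℤ) (z : ℂ) :
    ‖((japSq k ^ (r / 2) : ℝ) : ℂ) * z‖ ^ (2 : ℝ) = japSq k ^ r * ‖z‖ ^ 2 := by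
  have h := (japSq_pos k).le
  rw [norm_mul, Complex.norm_real, Real.norm_of_nonneg (Real.rpow_nonneg h _), Real.rpow_two,
    mul_pow, ← Real.rpow_natCast, ← Real.rpow_mul h]
  norm_num

theorem memℓp_iff_summable_sobolev (r : ℝ) (c : ℤ × ℤ → ℂ) :
    Memℓp (fun k => ((japSq k ^ (r / 2) : ℝ) : ℂ) * c k) 2 ↔
      Summable (fun k => japSq k ^ r * ‖c k‖ ^ 2) := by
  rw [memℓp_gen_iff (by norm_num)]
  refine summable_congr fun k => ?_
  rw [← japSq_rpow_mul_sq]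
  norm_num

theorem continuous_fourierCoeff_right (f : C(Torus × Torus, ℂ)) (n : ℤ) :
    Continuous (fun x : Torus => fourierCoeff (fun y => f (x, y)) n) := by
  unfold fourierCoeff
  have h : Continuous (Function.uncurry fun (x y : Torus) => fourier (-n) y • f (x, y)) := by
    simp only [Function.uncurry_def]
    fun_prop
  simpa using continuous_parametric_integral_of_continuous (μ := AddCircle.haarAddCircle)
    h isCompact_univ

theorem integrable_of_continuous_torus {g : Torus → ℂ} (hg : Continuous g) :
    Integrable g (AddCircle.haarAddCircle (T := 2 * Real.pi)) :=
  hg.integrable_of_hasCompactSupport (HasCompactSupport.of_compactSpace g)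

theorem torusCoeff_add (f g : C(Torus × Torus, ℂ)) (k : ℤ × ℤ) :
    torusCoeff (f + g) k = torusCoeff f k + torusCoeff g k := by
  have h1 : ∀ x : Torus, fourierCoeff (fun y => (f + g) (x, y)) k.2 =
      fourierCoeff (fun y => f (x, y)) k.2 + fourierCoeff (fun y => g (x, y)) k.2 := fun x =>
    congrFun (fourierCoeff.add (f := fun y => f (x, y)) (g := fun y => g (x, y))
      (integrable_of_continuous_torus (by fun_prop))
      (integrable_of_continuous_torus (by fun_prop))) k.2
  have h2 := congrFun (fourierCoeff.add
    (integrable_of_continuous_torus (continuous_fourierCoeff_right f k.2))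
    (integrable_of_continuous_torus (continuous_fourierCoeff_right g k.2))) k.1
  unfold torusCoeff
  rw [Pi.add_apply] at h2
  rw [← h2]
  congr 1
  funext x
  exact h1 x

theorem torusCoeff_smul (c : ℂ) (f : C(Torus × Torus, ℂ)) (k : ℤ × ℤ) :
    torusCoeff (c • f : C(Torus × Torus, ℂ)) k = c * torusCoeff f k := by
  unfold torusCoeff
  have h1 : ∀ x : Torus, fourierCoeff (fun y => (c • f : C(Torus × Torus, ℂ)) (x, y)) k.2 =
      c * fourierCoeff (fun y => f (x, y)) k.2 := fun x =>
    fourierCoeff.const_mul (fun y => f (x, y)) c k.2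
  simp_rw [h1]
  exact fourierCoeff.const_mul _ c k.1

/-- The weights `(1 + |k|²)^{-r}` are summable over `ℤ²` when `r > 1`. -/
theorem summable_japSq_rpow_neg {r : ℝ} (hr : 1 < r) :
    Summable (fun k : ℤ × ℤ => japSq k ^ (-r)) := by
  have h1 : Summable (fun n : ℤ => (1 + (n : ℝ) ^ 2) ^ (-(r / 2))) := by
    have h := Real.summable_abs_int_rpow hr
    refine Summable.of_norm_bounded_eventually h ?_
    have : ∀ᶠ n : ℤ in cofinite, n ≠ 0 := by
      simpa using (Set.finite_singleton (0 : ℤ)).compl_mem_cofinite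
    filter_upwards [this] with n hn
    have hn' : 0 < |(n : ℝ)| := by positivity
    rw [Real.norm_of_nonneg (by positivity)]
    have e : |(n : ℝ)| ^ (-r) = ((n : ℝ) ^ 2) ^ (-(r / 2)) := by
      rw [← sq_abs, ← Real.rpow_natCast, ← Real.rpow_mul hn'.le]
      congr 1
      push_cast
      ring
    rw [e]
    exact Real.rpow_le_rpow_of_nonpos (by positivity) (by linarith) (by linarith)
  have h2 := h1.mul_of_nonneg h1 (fun n => by positivity) (fun n => by positivity)
  refine Summable.of_nonneg_of_le (fun k => Real.rpow_nonneg (japSq_pos k).le _) (fun k => ?_) h2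
  have ha : (0 : ℝ) < 1 + (k.1 : ℝ) ^ 2 := by positivity
  have hb : (0 : ℝ) < 1 + (k.2 : ℝ) ^ 2 := by positivity
  have hj := japSq_pos k
  rw [← Real.mul_rpow ha.le hb.le]
  have e : japSq k ^ (-r) = (japSq k ^ 2) ^ (-(r / 2)) := by
    rw [← Real.rpow_natCast, ← Real.rpow_mul hj.le]
    congr 1
    push_cast
    ring
  rw [e]
  refine Real.rpow_le_rpow_of_nonpos (by positivity) ?_ (by linarith)
  unfold japSq
  nlinarith [sq_nonneg (k.1 : ℝ), sq_nonneg (k.2 : ℝ), mul_nonneg (sq_nonneg (k.1 : ℝ)) (sq_nonneg (k.2 : ℝ))]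

theorem summable_norm_coeff {r : ℝ} (hr : 1 < r) {c : ℤ × ℤ → ℂ}
    (hc : Summable (fun k => japSq k ^ r * ‖c k‖ ^ 2)) : Summable (fun k => ‖c k‖) := by
  refine Summable.of_nonneg_of_le (fun k => norm_nonneg _) (fun k => ?_)
    (((summable_japSq_rpow_neg hr).add hc))
  have hj := japSq_pos k
  have hp : 0 < japSq k ^ r := Real.rpow_pos_of_pos hj _
  rw [Real.rpow_neg hj.le]
  have hi : 0 < (japSq k ^ r)⁻¹ := by positivity
  have hm : (japSq k ^ r)⁻¹ * japSq k ^ r = 1 := inv_mul_cancel₀ hp.ne'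
  have : 0 ≤ (japSq k ^ r)⁻¹ * (1 - japSq k ^ r * ‖c k‖) ^ 2 := by positivity
  have e : (japSq k ^ r)⁻¹ * (1 - japSq k ^ r * ‖c k‖) ^ 2 =
      (japSq k ^ r)⁻¹ + japSq k ^ r * ‖c k‖ ^ 2 - 2 * ‖c k‖ := by
    field_simp
    ring
  have := norm_nonneg (c k)
  linarith

theorem norm_fourier_eval (n : ℤ) (x : Torus) : ‖fourier n x‖ = 1 := by
  rw [fourier_apply]
  exact Circle.norm_coe _

/-- A continuous function on the torus with absolutely summable Fourier coefficients is the sum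
of its Fourier series. -/
theorem hasSum_torusCoeff (f : C(Torus × Torus, ℂ)) (hf : Summable (fun k => ‖torusCoeff f k‖))
    (x y : Torus) :
    HasSum (fun k : ℤ × ℤ => torusCoeff f k * (fourier k.1 x * fourier k.2 y)) (f (x, y)) := by
  have hs : Summable (fun k : ℤ × ℤ => torusCoeff f k * (fourier k.1 x * fourier k.2 y)) := by
    refine Summable.of_norm (hf.congr fun k => ?_)
    rw [norm_mul, norm_mul, norm_fourier_eval, norm_fourier_eval, mul_one, mul_one]
  have hs' := hs.prod_symm
  have inner : ∀ q : ℤ, HasSum (fun p : ℤ => torusCoeff f (p, q) * (fourier p x * fourier q y))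
      (fourierCoeff (fun y => f (x, y)) q * fourier q y) := by
    intro q
    let F : C(Torus, ℂ) := ⟨_, continuous_fourierCoeff_right f q⟩
    have hF : Summable (fourierCoeff F) := by
      have := hf.prod_symm.prod_factor q
      exact Summable.of_norm this
    have := (has_pointwise_sum_fourier_series_of_summable hF x).mul_right (fourier q y)
    refine this.congr_fun fun p => ?_
    simp only [smul_eq_mul, torusCoeff, F, ContinuousMap.coe_mk]
    ring
  have hout := hs'.hasSum.prod_fiberwise (fun q => inner q)
  let G : C(Torus, ℂ) := ⟨fun y => f (x, y), by fun_prop⟩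
  have hG : Summable (fourierCoeff G) := by
    have h := hout.summable.norm
    refine Summable.of_norm (h.congr fun q => ?_)
    rw [norm_mul, norm_fourier_eval, mul_one]
    rfl
  have := has_pointwise_sum_fourier_series_of_summable hG y
  have key : f (x, y) = ∑' (c : ℤ × ℤ), torusCoeff f c.swap *
      (fourier c.swap.1 x * fourier c.swap.2 y) :=
    this.unique hout
  rw [key]
  have := hs'.hasSum
  rw [← (Equiv.prodComm ℤ ℤ).hasSum_iff]
  exact this

/-- The functions in `H^r(𝕋²)`, `r > 1`: those whose Fourier coefficients satisfy
`∑ (1 + |k|²)^r |f̂(k)|² < ∞`. As `r > 1 = d/2`, every class in `H^r(𝕋²)` has exactly one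
continuous representative, so that `H^r(𝕋²)` is realised inside the continuous functions. -/
def sobolevSubmodule (r : ℝ) (_hr : 1 < r) : Submodule ℂ C(Torus × Torus, ℂ) where
  carrier := {f | Summable (fun k => japSq k ^ r * ‖torusCoeff f k‖ ^ 2)}
  zero_mem' := by
    have h : ∀ k, torusCoeff (0 : C(Torus × Torus, ℂ)) k = 0 := fun k => by
      simpa using torusCoeff_smul 0 0 k
    simp only [Set.mem_ofPred_eq, h]
    simp
  add_mem' := by
    intro f g hf hg
    simp only [Set.mem_ofPred_eq, ← memℓp_iff_summable_sobolev] at hf hg ⊢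
    convert hf.add hg using 1
    funext k
    simp only [ContinuousMap.coe_add, torusCoeff_add, Pi.add_apply]
    ring
  smul_mem' := by
    intro c f hf
    simp only [Set.mem_ofPred_eq, ← memℓp_iff_summable_sobolev] at hf ⊢
    convert hf.const_smul c using 1
    funext k
    simp only [torusCoeff_smul, Pi.smul_apply, smul_eq_mul]
    ring

/-- The Sobolev space `H^r(𝕋²)`, `r > 1`. It is a type of its own, since its norm is not the
supremum norm. -/
def SobolevSpace (r : ℝ) (hr : 1 < r) : Type := sobolevSubmodule r hr

instance (r : ℝ) (hr : 1 < r) : AddCommGroup (SobolevSpace r hr) :=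
  inferInstanceAs (AddCommGroup (sobolevSubmodule r hr))

instance (r : ℝ) (hr : 1 < r) : Module ℂ (SobolevSpace r hr) :=
  inferInstanceAs (Module ℂ (sobolevSubmodule r hr))

namespace SobolevSpace

variable {r : ℝ} {hr : 1 < r}

/-- The underlying continuous function. -/
def toFun (f : SobolevSpace r hr) : C(Torus × Torus, ℂ) := f.1

/-- The weighted Fourier coefficients `(1 + |k|²)^{r/2} f̂(k)`, as an element of `ℓ²(ℤ²)`. -/
def weighted (r : ℝ) (hr : 1 < r) :
    SobolevSpace r hr →ₗ[ℂ] lp (fun _ : ℤ × ℤ => ℂ) 2 where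
  toFun f := ⟨fun k => ((japSq k ^ (r / 2) : ℝ) : ℂ) * torusCoeff f.toFun k,
    (memℓp_iff_summable_sobolev r _).2 f.2⟩
  map_add' f g := by
    ext k
    change _ * torusCoeff (f.toFun + g.toFun) k = _ * _ + _ * _
    rw [torusCoeff_add]
    ring
  map_smul' c f := by
    ext k
    change _ * torusCoeff (c • f.toFun : C(Torus × Torus, ℂ)) k = c * (_ * _)
    rw [torusCoeff_smul]
    ring

theorem hasSum (f : SobolevSpace r hr) (x y : Torus) :
    HasSum (fun k : ℤ × ℤ => torusCoeff f.toFun k * (fourier k.1 x * fourier k.2 y))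
      (f.toFun (x, y)) :=
  hasSum_torusCoeff f.toFun (summable_norm_coeff hr f.2) x y

theorem weighted_injective (r : ℝ) (hr : 1 < r) : Function.Injective (weighted r hr) := by
  rw [injective_iff_map_eq_zero]
  intro f hf
  have h : ∀ k, torusCoeff f.toFun k = 0 := by
    intro k
    have hk : ((japSq k ^ (r / 2) : ℝ) : ℂ) * torusCoeff f.toFun k = 0 :=
      congrFun (congrArg (fun g : lp (fun _ : ℤ × ℤ => ℂ) 2 => (g : ℤ × ℤ → ℂ)) hf) k
    have hp : ((japSq k ^ (r / 2) : ℝ) : ℂ) ≠ 0 :=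
      Complex.ofReal_ne_zero.2 (Real.rpow_pos_of_pos (japSq_pos k) _).ne'
    exact (mul_eq_zero.1 hk).resolve_left hp
  have h0 : f.toFun = 0 := by
    ext ⟨x, y⟩
    have := f.hasSum x y
    simp only [h, zero_mul] at this
    exact this.unique hasSum_zero
  exact Subtype.ext h0

/-- The norm of `H^r(𝕋²)`, transported from `ℓ²(ℤ²)`; see `norm_sq`. -/
instance : NormedAddCommGroup (SobolevSpace r hr) :=
  NormedAddCommGroup.induced _ _ (weighted r hr) (weighted_injective r hr)

instance : NormedSpace ℂ (SobolevSpace r hr) :=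
  NormedSpace.induced ℂ _ _ (weighted r hr)

/-- `‖f‖_r² = ∑ (1 + |k|²)^r |f̂(k)|²`. -/
theorem norm_sq (f : SobolevSpace r hr) :
    ‖f‖ ^ 2 = ∑' k, japSq k ^ r * ‖torusCoeff f.toFun k‖ ^ 2 := by
  change ‖weighted r hr f‖ ^ 2 = _
  have h := lp.norm_rpow_eq_tsum (p := 2) (by norm_num) (weighted r hr f)
  norm_num at h
  rw [h]
  refine tsum_congr fun k => ?_
  rw [← japSq_rpow_mul_sq, Real.rpow_two]
  rfl

/-- Sobolev's inequality in dimension two: point evaluations are bounded on `H^r`, `r > 1`. -/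
theorem norm_eval_le (f : SobolevSpace r hr) (x : Torus × Torus) :
    ‖f.toFun x‖ ≤ (∑' k, japSq k ^ (-r)) ^ (1 / 2 : ℝ) * ‖f‖ := by
  have hs := summable_norm_coeff hr f.2
  have h1 : ‖f.toFun x‖ ≤ ∑' k, ‖torusCoeff f.toFun k‖ := by
    rw [← (f.hasSum x.1 x.2).tsum_eq]
    refine (norm_tsum_le_tsum_norm (hs.congr fun k => ?_)).trans (le_of_eq (tsum_congr fun k => ?_))
    · rw [norm_mul, norm_mul, norm_fourier_eval, norm_fourier_eval, mul_one, mul_one]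
      rfl
    · rw [norm_mul, norm_mul, norm_fourier_eval, norm_fourier_eval, mul_one, mul_one]
  refine h1.trans ?_
  have hA : ∀ k, (japSq k ^ (-(r / 2))) ^ (2 : ℝ) = japSq k ^ (-r) := fun k => by
    rw [← Real.rpow_mul (japSq_pos k).le]
    congr 1
    ring
  have hB : ∀ k, (‖((japSq k ^ (r / 2) : ℝ) : ℂ) * torusCoeff f.toFun k‖) ^ (2 : ℝ) =
      japSq k ^ r * ‖torusCoeff f.toFun k‖ ^ 2 := fun k => japSq_rpow_mul_sq r k _
  have h := Real.inner_le_Lp_mul_Lq_tsum_of_nonneg (p := 2) (q := 2)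
    (f := fun k => japSq k ^ (-(r / 2)))
    (g := fun k => ‖((japSq k ^ (r / 2) : ℝ) : ℂ) * torusCoeff f.toFun k‖)
    (Real.HolderConjugate.two_two) (fun k => Real.rpow_nonneg (japSq_pos k).le _)
    (fun k => norm_nonneg _) (by simpa only [hA] using summable_japSq_rpow_neg hr)
    (by simp only [hB]; exact f.2)
  simp only [hA, hB] at h
  rw [← norm_sq, ← Real.sqrt_eq_rpow (‖f‖ ^ 2), Real.sqrt_sq (norm_nonneg f)] at h
  refine le_trans (le_of_eq (tsum_congr fun k => ?_)) h
  have hj := japSq_pos k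
  rw [norm_mul, Complex.norm_real, Real.norm_of_nonneg (Real.rpow_nonneg hj.le _), ← mul_assoc,
    ← Real.rpow_add hj]
  simp

end SobolevSpace

/-- The space of distributions `H^{-r}(𝕋²)`, the dual of `H^r(𝕋²)` with the dual norm. -/
abbrev NegSobolev (r : ℝ) (hr : 1 < r) : Type := StrongDual ℂ (SobolevSpace r hr)

/-- The Dirac mass at a point of `𝕋²`, as an element of `H^{-r}(𝕋²)`. -/
def diracMass (r : ℝ) (hr : 1 < r) (x : Torus × Torus) : NegSobolev r hr :=
  LinearMap.mkContinuous
    { toFun := fun f => f.toFun x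
      map_add' := fun _ _ => rfl
      map_smul' := fun _ _ => rfl }
    ((∑' k, japSq k ^ (-r)) ^ (1 / 2 : ℝ)) (fun f => f.norm_eval_le x)

/-! ### The random graphs and the initial conditions -/

/-- Sequences `(ξ^{(n)})_n` of directed graphs on `n` vertices, loops allowed: `G n i j = true`
means `ξ^{(n)}_{ij} = 1`. -/
abbrev GraphSeq : Type := (n : ℕ) → Fin n → Fin n → Bool

/-- Sequences `(θ_0^{1,n}, …, θ_0^{n,n})_n` of initial conditions. -/
abbrev InitSeq : Type := (n : ℕ) → Fin n → Torus

/-- The numbers `ξ^{(n)}_{ij}`, with values in `{0, 1}`. -/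
def xi (G : GraphSeq) (n : ℕ) (i j : Fin n) : ℝ := if G n i j then 1 else 0

/-- Under the law `Pg`, for each `n ≥ 2` the `ξ^{(n)}_{ij}` are independent Bernoulli variables of
parameter `p n ∈ (0, 1]`. Nothing is said about the joint law of the graphs of different sizes. -/
structure IsErdosRenyi (p : ℕ → ℝ) (Pg : Measure GraphSeq) : Prop where
  pos : ∀ n, 2 ≤ n → 0 < p n
  le_one : ∀ n, 2 ≤ n → p n ≤ 1
  indep : ∀ n, 2 ≤ n → iIndepFun (fun (e : Fin n × Fin n) (G : GraphSeq) => G n e.1 e.2) Pg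
  bernoulli : ∀ n, 2 ≤ n → ∀ i j : Fin n, Pg {G | G n i j = true} = ENNReal.ofReal (p n)

/-- The recentred edge variables `ξ^{(n)}_{ij} / p_n - 1`. -/
def hatXi (p : ℕ → ℝ) (G : GraphSeq) (n : ℕ) (i j : Fin n) : ℝ := xi G n i j / p n - 1

/-- The weighted empirical measure
`n⁻² ∑_{i,j} (ξ^{(n)}_{ij} / p_n - 1) δ_{θ^{i,n}} ⊗ δ_{θ^{j,n}}`, as an element of `H^{-r}(𝕋²)`. -/
def hatNu (r : ℝ) (hr : 1 < r) (p : ℕ → ℝ) (n : ℕ) (G : GraphSeq) (θ : InitSeq) :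
    NegSobolev r hr :=
  ((1 / (n : ℝ) ^ 2 : ℝ) : ℂ) •
    ∑ i : Fin n, ∑ j : Fin n, ((hatXi p G n i j : ℝ) : ℂ) • diracMass r hr (θ n i, θ n j)

/-- The rescaled measure `√n ν̂^n`, at time zero. -/
def hatEta (r : ℝ) (hr : 1 < r) (p : ℕ → ℝ) (n : ℕ) (G : GraphSeq) (θ : InitSeq) :
    NegSobolev r hr :=
  ((Real.sqrt n : ℝ) : ℂ) • hatNu r hr p n G θ

/-- The law `P_0` that the quenched expectation `E_0` integrates against: the law of the initial
condition when the graph sequence is frozen at `G`. If the initial condition is independent of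
the graph, this is the marginal law `P.snd` for almost every `G`, see `quenchedLaw_eq_snd`. -/
def quenchedLaw (P : Measure (GraphSeq × InitSeq)) [IsProbabilityMeasure P] (G : GraphSeq) :
    Measure InitSeq :=
  P.condKernel G

instance (P : Measure (GraphSeq × InitSeq)) [IsProbabilityMeasure P] (G : GraphSeq) :
    IsProbabilityMeasure (quenchedLaw P G) :=
  inferInstanceAs (IsProbabilityMeasure (P.condKernel G))

theorem quenchedLaw_eq_snd (P : Measure (GraphSeq × InitSeq)) [IsProbabilityMeasure P]
    (h : P = P.fst.prod P.snd) : ∀ᵐ G ∂P.fst, quenchedLaw P G = P.snd := by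
  have := eq_condKernel_of_measure_eq_compProd (ρ := P) (Kernel.const GraphSeq P.snd)
    (by rw [Measure.compProd_const]; exact h)
  filter_upwards [this] with G hG
  rw [quenchedLaw, ← hG, Kernel.const_apply]

end

/-!
All three conclusions hold on the event that `∑ₙ E₀[Qₙ] < ∞`, where
`Qₙ = ∑ₖ (1 + |k|²)^{-r} |η̂ₙ(k)|⁴` is built from the Fourier modes of `hatEta`; any `r > 1` will do.

By Cauchy–Schwarz the norm of `H^{-r}` satisfies `‖η‖² ≤ ∑ₖ (1 + |k|²)^{-r} |η̂(k)|²`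
(`HasModes.norm_sq_le`). As `x² ≤ δ + x⁴ / δ` and the weights have finite total mass `W`, this gives
`‖η‖² ≤ δ W + Q / δ` for every `δ > 0` (`HasModes.enorm_sq_le`). Hence `E₀[Qₙ] → 0` forces
`E₀‖ηₙ‖² → 0`, and boundedness of `E₀[Qₙ]` bounds every moment of order at most two. Convergence in
law follows from Chebyshev's inequality.

That the series converges almost surely is a first moment computation. Graph and initial condition
are independent, so the graph can be averaged first with the angles frozen. Each mode is then `√n / n²`
times a sum of `n²` independent centred variables of size at most `1 / p`, whose fourth moment is at
most `3 (n² / p)² + n² / p³` up to a constant (`integral_sum_pow_four_le`). So the mean of `Qₙ` is of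
order `1 / (n² p²) + 1 / (n⁴ p³)`. The assumption on `p` gives `p ≥ n^{-1/3}` for large `n`, and the
bound is `O(n^{-4/3})`, which is summable (`summable_modeBound`). Second moments alone would only give
`1 / (n p)`, which need not be summable; a summable bound is needed because nothing is known about
the joint law of the graphs of different sizes.
-/

/-! ### Fourier modes of distributions -/

/-- The character `x ↦ e^{i k·x}` of the two-dimensional torus. -/
noncomputable def torusChar (k : ℤ × ℤ) (x : Torus × Torus) : ℂ :=
  fourier k.1 x.1 * fourier k.2 x.2

theorem norm_torusChar (k : ℤ × ℤ) (x : Torus × Torus) : ‖torusChar k x‖ = 1 := by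
  rw [torusChar, norm_mul, norm_fourier_eval, norm_fourier_eval, mul_one]

theorem continuous_torusChar (k : ℤ × ℤ) : Continuous (torusChar k) := by
  unfold torusChar
  fun_prop

/-- The distribution `u` has the bounded family of modes `z`: it acts on a test function `f` by
`u f = ∑ f̂(k) z(k)`, that is, `z k` is the value of `u` at the character of index `k`. -/
structure HasModes {r : ℝ} {hr : 1 < r} (u : NegSobolev r hr) (z : ℤ × ℤ → ℂ) : Prop where
  bounded : ∃ C, ∀ k, ‖z k‖ ≤ C
  hasSum : ∀ f : SobolevSpace r hr, HasSum (fun k => torusCoeff f.toFun k * z k) (u f)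

namespace HasModes

variable {r : ℝ} {hr : 1 < r} {u v : NegSobolev r hr} {z w : ℤ × ℤ → ℂ}

theorem dirac (x : Torus × Torus) :
    HasModes (diracMass r hr x) (fun k => torusChar k x) where
  bounded := ⟨1, fun k => (norm_torusChar k x).le⟩
  hasSum f := f.hasSum x.1 x.2

theorem const_smul (c : ℂ) (h : HasModes u z) : HasModes (c • u) (fun k => c * z k) where
  bounded := by
    obtain ⟨C, hC⟩ := h.bounded
    exact ⟨‖c‖ * C, fun k => by rw [norm_mul]; gcongr; exact hC k⟩
  hasSum f := by
    refine ((h.hasSum f).mul_left c).congr_fun fun k => ?_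
    ring

theorem sub (hu : HasModes u z) (hv : HasModes v w) : HasModes (u - v) (fun k => z k - w k) where
  bounded := by
    obtain ⟨C, hC⟩ := hu.bounded
    obtain ⟨D, hD⟩ := hv.bounded
    exact ⟨C + D, fun k => (norm_sub_le _ _).trans (add_le_add (hC k) (hD k))⟩
  hasSum f := by
    refine ((hu.hasSum f).sub (hv.hasSum f)).congr_fun fun k => ?_
    ring

theorem sum {ι : Type*} (s : Finset ι) {u : ι → NegSobolev r hr} {z : ι → ℤ × ℤ → ℂ}
    (h : ∀ i ∈ s, HasModes (u i) (z i)) :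
    HasModes (∑ i ∈ s, u i) (fun k => ∑ i ∈ s, z i k) where
  bounded := by
    choose! C hC using fun i hi => (h i hi).bounded
    exact ⟨∑ i ∈ s, C i, fun k => (norm_sum_le _ _).trans
      (Finset.sum_le_sum fun i hi => hC i hi k)⟩
  hasSum f := by
    rw [_root_.sum_apply]
    refine (hasSum_sum fun i hi => (h i hi).hasSum f).congr_fun fun k => ?_
    rw [Finset.mul_sum]

theorem summable_sq (h : HasModes u z) : Summable (fun k => japSq k ^ (-r) * ‖z k‖ ^ 2) := by
  obtain ⟨C, hC⟩ := h.bounded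
  refine Summable.of_nonneg_of_le
    (fun k => mul_nonneg (Real.rpow_nonneg (japSq_pos k).le _) (by positivity)) (fun k => ?_)
    ((summable_japSq_rpow_neg hr).mul_right (C ^ 2))
  have := Real.rpow_nonneg (japSq_pos k).le (-r)
  gcongr
  exact hC k

/-- The easy half of the description of `‖·‖_{-r}` by Fourier modes: the Cauchy–Schwarz inequality
between `(1 + |k|²)^{r/2} f̂(k)` and `(1 + |k|²)^{-r/2} z(k)`. -/
theorem norm_sq_le (h : HasModes u z) : ‖u‖ ^ 2 ≤ ∑' k, japSq k ^ (-r) * ‖z k‖ ^ 2 := by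
  have hsq : ∀ (s : ℝ) k, (japSq k ^ (s / 2) * ‖z k‖) ^ (2 : ℝ) = japSq k ^ s * ‖z k‖ ^ 2 := by
    intro s k
    rw [← japSq_rpow_mul_sq, norm_mul, Complex.norm_real,
      Real.norm_of_nonneg (Real.rpow_nonneg (japSq_pos k).le _)]
  have hnn : 0 ≤ ∑' k, japSq k ^ (-r) * ‖z k‖ ^ 2 :=
    tsum_nonneg fun k => mul_nonneg (Real.rpow_nonneg (japSq_pos k).le _) (by positivity)
  have hu : ‖u‖ ≤ (∑' k, japSq k ^ (-r) * ‖z k‖ ^ 2) ^ (1 / 2 : ℝ) := by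
    refine ContinuousLinearMap.opNorm_le_bound _ (by positivity) fun f => ?_
    have hB : ∀ k, (‖((japSq k ^ (r / 2) : ℝ) : ℂ) * torusCoeff f.toFun k‖) ^ (2 : ℝ) =
        japSq k ^ r * ‖torusCoeff f.toFun k‖ ^ 2 := fun k => japSq_rpow_mul_sq r k _
    have hA := hsq (-r)
    obtain ⟨hs, hle⟩ := Real.summable_and_inner_le_Lp_mul_Lq_tsum_of_nonneg (p := 2) (q := 2)
      (f := fun k => japSq k ^ (-r / 2) * ‖z k‖)
      (g := fun k => ‖((japSq k ^ (r / 2) : ℝ) : ℂ) * torusCoeff f.toFun k‖)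
      (Real.HolderConjugate.two_two)
      (fun k => mul_nonneg (Real.rpow_nonneg (japSq_pos k).le _) (norm_nonneg _))
      (fun k => norm_nonneg _) (by simpa only [hA] using h.summable_sq)
      (by simp only [hB]; exact f.2)
    have e : ∀ k, japSq k ^ (-r / 2) * ‖z k‖ *
        ‖((japSq k ^ (r / 2) : ℝ) : ℂ) * torusCoeff f.toFun k‖ =
        ‖torusCoeff f.toFun k * z k‖ := fun k => by
      have hj := japSq_pos k
      have hj1 : japSq k ^ (-r / 2) * japSq k ^ (r / 2) = 1 := by
        rw [← Real.rpow_add hj, neg_div, neg_add_cancel, Real.rpow_zero]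
      rw [norm_mul, norm_mul, Complex.norm_real, Real.norm_of_nonneg (Real.rpow_nonneg hj.le _)]
      linear_combination ‖z k‖ * ‖torusCoeff f.toFun k‖ * hj1
    simp only [hA, hB, e] at hs hle
    rw [← SobolevSpace.norm_sq, ← Real.sqrt_eq_rpow (‖f‖ ^ 2),
      Real.sqrt_sq (norm_nonneg f)] at hle
    rw [← (h.hasSum f).tsum_eq]
    exact (norm_tsum_le_tsum_norm hs).trans hle
  rw [← Real.sqrt_eq_rpow] at hu
  calc ‖u‖ ^ 2 ≤ Real.sqrt (∑' k, japSq k ^ (-r) * ‖z k‖ ^ 2) ^ 2 := by gcongr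
    _ = _ := Real.sq_sqrt hnn

/-- Since the weights are summable, a small multiple of their total mass makes up for replacing
squares of the modes by fourth powers. -/
theorem enorm_sq_le (h : HasModes u z) {δ : ℝ} (hδ : 0 < δ) :
    ‖u‖ₑ ^ 2 ≤ ENNReal.ofReal (δ * ∑' k, japSq k ^ (-r)) +
      ENNReal.ofReal δ⁻¹ * ∑' k, ENNReal.ofReal (japSq k ^ (-r)) * ‖z k‖ₑ ^ 4 := by
  have hw : ∀ k, 0 ≤ japSq k ^ (-r) := fun k => Real.rpow_nonneg (japSq_pos k).le _
  have h1 : ‖u‖ₑ ^ 2 = ENNReal.ofReal (‖u‖ ^ 2) := by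
    rw [← ofReal_norm, ENNReal.ofReal_pow (norm_nonneg _)]
  rw [h1, ENNReal.ofReal_mul hδ.le,
    ENNReal.ofReal_tsum_of_nonneg hw (summable_japSq_rpow_neg hr), ← ENNReal.tsum_mul_left,
    ← ENNReal.tsum_mul_left, ← ENNReal.tsum_add]
  refine (ENNReal.ofReal_le_ofReal h.norm_sq_le).trans ?_
  rw [ENNReal.ofReal_tsum_of_nonneg (fun k => mul_nonneg (hw k) (by positivity)) h.summable_sq]
  refine ENNReal.tsum_le_tsum fun k => ?_
  have h4 : ‖z k‖ₑ ^ 4 = ENNReal.ofReal (‖z k‖ ^ 4) := by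
    rw [← ofReal_norm, ENNReal.ofReal_pow (norm_nonneg _)]
  rw [h4, ← ENNReal.ofReal_mul (hw k), ← ENNReal.ofReal_mul hδ.le,
    ← ENNReal.ofReal_mul (by positivity), ← ENNReal.ofReal_add
      (mul_nonneg hδ.le (hw k)) (mul_nonneg (by positivity) (mul_nonneg (hw k) (by positivity)))]
  refine ENNReal.ofReal_le_ofReal ?_
  have key : ‖z k‖ ^ 2 ≤ δ + δ⁻¹ * ‖z k‖ ^ 4 := by
    have e : δ + δ⁻¹ * ‖z k‖ ^ 4 - ‖z k‖ ^ 2 =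
        δ⁻¹ * ((δ - ‖z k‖ ^ 2 / 2) ^ 2 + 3 / 4 * ‖z k‖ ^ 4) := by
      field_simp
      ring
    have : 0 ≤ δ⁻¹ * ((δ - ‖z k‖ ^ 2 / 2) ^ 2 + 3 / 4 * ‖z k‖ ^ 4) := by positivity
    linarith
  calc _ ≤ japSq k ^ (-r) * (δ + δ⁻¹ * ‖z k‖ ^ 4) := mul_le_mul_of_nonneg_left key (hw k)
    _ = _ := by ring

end HasModes

/-- The series over the modes converges uniformly. This makes `hatEta` measurable in the initial
condition, as a continuous function of the angles; no separability of `H^{-r}` is needed. -/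
theorem continuous_diracMass (r : ℝ) (hr : 1 < r) : Continuous (diracMass r hr) := by
  rw [continuous_iff_continuousAt]
  intro x
  rw [ContinuousAt, tendsto_iff_norm_sub_tendsto_zero]
  have hw : ∀ k, 0 ≤ japSq k ^ (-r) := fun k => Real.rpow_nonneg (japSq_pos k).le _
  have hc : Continuous fun y =>
      ∑' k, japSq k ^ (-r) * ‖torusChar k y - torusChar k x‖ ^ 2 := by
    refine continuous_tsum (fun k => ?_) ((summable_japSq_rpow_neg hr).mul_right (2 ^ 2))
      (fun k y => ?_)
    · have := continuous_torusChar k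
      fun_prop
    · rw [Real.norm_of_nonneg (mul_nonneg (hw k) (by positivity))]
      refine mul_le_mul_of_nonneg_left ?_ (hw k)
      gcongr
      refine (norm_sub_le _ _).trans ?_
      rw [norm_torusChar, norm_torusChar]
      norm_num
  have h0 := hc.tendsto x
  simp only [sub_self, norm_zero, ne_eq, OfNat.ofNat_ne_zero, not_false_eq_true, zero_pow,
    mul_zero, tsum_zero] at h0
  have h2 : Tendsto (fun y => ‖diracMass r hr y - diracMass r hr x‖ ^ 2) (𝓝 x) (𝓝 0) :=
    squeeze_zero (fun y => by positivity)
      (fun y => ((HasModes.dirac y).sub (HasModes.dirac x)).norm_sq_le) h0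
  have h3 := h2.sqrt
  simpa using h3

/-! ### Fourth moments of sums of independent centred variables -/

/-- For independent centred variables, odd mixed moments vanish, so that the fourth moment of a
sum of `N` terms grows like `N²` and not like `N⁴`. -/
theorem integral_sum_pow_four_le {Ω ι : Type*} [MeasurableSpace Ω] {μ : Measure Ω}
    [IsProbabilityMeasure μ] {Y : ι → Ω → ℝ} (hY : ∀ i, Measurable (Y i)) {C : ℝ}
    (hC : ∀ i ω, |Y i ω| ≤ C) (hind : iIndepFun Y μ) (h1 : ∀ i, ∫ ω, Y i ω ∂μ = 0) {v κ : ℝ}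
    (h2 : ∀ i, ∫ ω, Y i ω ^ 2 ∂μ ≤ v) (h4 : ∀ i, ∫ ω, Y i ω ^ 4 ∂μ ≤ κ) (s : Finset ι) :
    ∫ ω, (∑ i ∈ s, Y i ω) ^ 4 ∂μ ≤ 3 * (s.card * v) ^ 2 + s.card * κ := by
  classical
  have hbdd : ∀ f : Ω → ℝ, Measurable f → (∃ D, ∀ ω, |f ω| ≤ D) → Integrable f μ := by
    rintro f hf ⟨D, hD⟩
    exact Integrable.of_bound hf.aestronglyMeasurable D (Eventually.of_forall hD)
  have hS : ∀ t : Finset ι, Measurable fun ω => ∑ i ∈ t, Y i ω := fun t => by fun_prop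
  have hSb : ∀ (t : Finset ι) ω, |∑ i ∈ t, Y i ω| ≤ t.card * C := fun t ω => by
    refine (Finset.abs_sum_le_sum_abs _ _).trans ?_
    refine (Finset.sum_le_sum fun i _ => hC i ω).trans ?_
    simp
  have hSi : ∀ (t : Finset ι) (m : ℕ), Integrable (fun ω => (∑ i ∈ t, Y i ω) ^ m) μ :=
    fun t m => hbdd _ ((hS t).pow_const m) ⟨(t.card * C) ^ m, fun ω => by
      rw [abs_pow]; gcongr; exact hSb t ω⟩
  have hYi : ∀ (i : ι) (m : ℕ), Integrable (fun ω => Y i ω ^ m) μ := fun i m => by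
    simpa using hSi {i} m
  have hprod : ∀ (t : Finset ι) (i : ι), i ∉ t → ∀ a b : ℕ,
      Integrable (fun ω => (∑ j ∈ t, Y j ω) ^ a * Y i ω ^ b) μ ∧
      ∫ ω, (∑ j ∈ t, Y j ω) ^ a * Y i ω ^ b ∂μ =
        (∫ ω, (∑ j ∈ t, Y j ω) ^ a ∂μ) * ∫ ω, Y i ω ^ b ∂μ := by
    intro t i hi a b
    have hI : IndepFun (fun ω => (∑ j ∈ t, Y j ω) ^ a) (fun ω => Y i ω ^ b) μ := by
      have := (hind.indepFun_finsetSum_of_notMem hY hi).comp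
        (measurable_id.pow_const a) (measurable_id.pow_const b)
      simpa [Function.comp_def] using this
    exact ⟨hI.integrable_mul (hSi t a) (hYi i b), hI.integral_fun_mul_eq_mul_integral
      (hSi t a).aestronglyMeasurable (hYi i b).aestronglyMeasurable⟩
  have hsecond : ∀ t : Finset ι, ∫ ω, (∑ i ∈ t, Y i ω) ^ 2 ∂μ ≤ t.card * v := by
    intro t
    induction t using Finset.induction_on with
    | empty => simp
    | insert i t hi ih =>
      have e : ∀ ω, (∑ j ∈ insert i t, Y j ω) ^ 2 = (∑ j ∈ t, Y j ω) ^ 2 +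
          2 * ((∑ j ∈ t, Y j ω) ^ 1 * Y i ω ^ 1) + Y i ω ^ 2 := fun ω => by
        rw [Finset.sum_insert hi]; ring
      simp only [e]
      rw [integral_add ((hSi t 2).fun_add ((hprod t i hi 1 1).1.const_mul 2)) (hYi i 2),
        integral_add (hSi t 2) ((hprod t i hi 1 1).1.const_mul 2), integral_const_mul,
        (hprod t i hi 1 1).2]
      simp only [pow_one, h1, mul_zero, add_zero]
      rw [Finset.card_insert_of_notMem hi]
      push_cast
      linarith [h2 i]
  induction s using Finset.induction_on with
  | empty => simp
  | insert i t hi ih =>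
    have e : ∀ ω, (∑ j ∈ insert i t, Y j ω) ^ 4 = (∑ j ∈ t, Y j ω) ^ 4 +
        4 * ((∑ j ∈ t, Y j ω) ^ 3 * Y i ω ^ 1) + 6 * ((∑ j ∈ t, Y j ω) ^ 2 * Y i ω ^ 2) +
        4 * ((∑ j ∈ t, Y j ω) ^ 1 * Y i ω ^ 3) + Y i ω ^ 4 := fun ω => by
      rw [Finset.sum_insert hi]; ring
    have i31 := (hprod t i hi 3 1).1.const_mul 4
    have i22 := (hprod t i hi 2 2).1.const_mul 6
    have i13 := (hprod t i hi 1 3).1.const_mul 4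
    have hT1 : ∫ ω, ∑ j ∈ t, Y j ω ∂μ = 0 := by
      rw [integral_finsetSum _ fun j _ => by simpa using hYi j 1]
      simp [h1]
    simp only [e]
    rw [integral_add ((((hSi t 4).fun_add i31).fun_add i22).fun_add i13) (hYi i 4),
      integral_add (((hSi t 4).fun_add i31).fun_add i22) i13, integral_add ((hSi t 4).fun_add i31) i22,
      integral_add (hSi t 4) i31, integral_const_mul, integral_const_mul, integral_const_mul,
      (hprod t i hi 3 1).2, (hprod t i hi 2 2).2, (hprod t i hi 1 3).2]
    simp only [pow_one, h1, hT1, mul_zero, zero_mul, add_zero]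
    have hv : 0 ≤ v := (integral_nonneg fun ω => by positivity).trans (h2 i)
    have hm : (∫ ω, (∑ j ∈ t, Y j ω) ^ 2 ∂μ) * ∫ ω, Y i ω ^ 2 ∂μ ≤ t.card * v * v :=
      mul_le_mul (hsecond t) (h2 i) (integral_nonneg fun ω => by positivity) (by positivity)
    rw [Finset.card_insert_of_notMem hi]
    push_cast
    nlinarith [h4 i, sq_nonneg v]

/-! ### Moments of the recentred edge variables -/

theorem measurable_edge (n : ℕ) (i j : Fin n) : Measurable fun G : GraphSeq => G n i j :=
  (measurable_pi_apply j).comp ((measurable_pi_apply i).comp (measurable_pi_apply n))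

theorem measurable_hatXi (p : ℕ → ℝ) (n : ℕ) (i j : Fin n) :
    Measurable fun G : GraphSeq => hatXi p G n i j :=
  (measurable_of_countable fun b : Bool => (if b then (1 : ℝ) else 0) / p n - 1).comp
    (measurable_edge n i j)

namespace IsErdosRenyi

variable {p : ℕ → ℝ} {Pg : Measure GraphSeq}

theorem abs_hatXi_le (h : IsErdosRenyi p Pg) {n : ℕ} (hn : 2 ≤ n) (i j : Fin n) (G : GraphSeq) :
    |hatXi p G n i j| ≤ (p n)⁻¹ := by
  have h0 := h.pos n hn
  have h1 := (one_le_inv₀ h0).2 (h.le_one n hn)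
  unfold hatXi xi
  rw [abs_le]
  split_ifs
  · rw [one_div]; constructor <;> linarith
  · rw [zero_div]; constructor <;> linarith

variable [IsProbabilityMeasure Pg]

theorem integral_edge (h : IsErdosRenyi p Pg) {n : ℕ} (hn : 2 ≤ n) (i j : Fin n) (g : Bool → ℝ) :
    ∫ G, g (G n i j) ∂Pg = p n * g true + (1 - p n) * g false := by
  have hm : MeasurableSet {G : GraphSeq | G n i j = true} :=
    measurable_edge n i j (measurableSet_singleton true)
  have e : ∀ G : GraphSeq, g (G n i j) = g false +
      {G : GraphSeq | G n i j = true}.indicator (fun _ => g true - g false) G := by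
    intro G
    by_cases hG : G n i j = true
    · rw [Set.indicator_of_mem (by exact hG), hG]
      ring
    · rw [Set.indicator_of_notMem (by exact hG), (by simpa using hG : G n i j = false), add_zero]
  simp only [e]
  rw [integral_add (integrable_const _) ((integrable_const _).indicator hm),
    integral_indicator_const _ hm, measureReal_def, h.bernoulli n hn,
    ENNReal.toReal_ofReal (h.pos n hn).le]
  simp only [integral_const, probReal_univ, smul_eq_mul]
  ring

theorem integral_hatXi (h : IsErdosRenyi p Pg) {n : ℕ} (hn : 2 ≤ n) (i j : Fin n) :
    ∫ G, hatXi p G n i j ∂Pg = 0 := by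
  have := h.integral_edge hn i j (fun b => (if b then (1 : ℝ) else 0) / p n - 1)
  refine this.trans ?_
  have := (h.pos n hn).ne'
  simp
  field_simp
  ring

theorem integral_hatXi_sq_le (h : IsErdosRenyi p Pg) {n : ℕ} (hn : 2 ≤ n) (i j : Fin n) :
    ∫ G, hatXi p G n i j ^ 2 ∂Pg ≤ (p n)⁻¹ := by
  have := h.integral_edge hn i j (fun b => ((if b then (1 : ℝ) else 0) / p n - 1) ^ 2)
  refine this.trans_le ?_
  have h0 := h.pos n hn
  have e : p n * (1 / p n - 1) ^ 2 + (1 - p n) * (0 / p n - 1) ^ 2 = (p n)⁻¹ - 1 := by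
    field_simp
    ring
  simp only [if_true, Bool.false_eq_true, if_false]
  linarith

theorem integrable_hatXi_pow (h : IsErdosRenyi p Pg) {n : ℕ} (hn : 2 ≤ n) (i j : Fin n) (m : ℕ) :
    Integrable (fun G => hatXi p G n i j ^ m) Pg := by
  refine Integrable.of_bound ((measurable_hatXi p n i j).pow_const m).aestronglyMeasurable
    ((p n)⁻¹ ^ m) (Eventually.of_forall fun G => ?_)
  rw [norm_pow, Real.norm_eq_abs]
  gcongr
  exact h.abs_hatXi_le hn i j G

/-- The fourth moment is compared with the second through the bound `|ξ / p - 1| ≤ 1 / p`. -/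
theorem integral_hatXi_pow_four_le (h : IsErdosRenyi p Pg) {n : ℕ} (hn : 2 ≤ n) (i j : Fin n) :
    ∫ G, hatXi p G n i j ^ 4 ∂Pg ≤ (p n)⁻¹ ^ 3 := by
  have h0 := h.pos n hn
  calc ∫ G, hatXi p G n i j ^ 4 ∂Pg ≤ ∫ G, (p n)⁻¹ ^ 2 * hatXi p G n i j ^ 2 ∂Pg := by
        refine integral_mono (h.integrable_hatXi_pow hn i j 4)
          ((h.integrable_hatXi_pow hn i j 2).const_mul _) fun G => ?_
        have : hatXi p G n i j ^ 2 ≤ (p n)⁻¹ ^ 2 := by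
          rw [← sq_abs]
          gcongr
          exact h.abs_hatXi_le hn i j G
        calc hatXi p G n i j ^ 4 = hatXi p G n i j ^ 2 * hatXi p G n i j ^ 2 := by ring
          _ ≤ _ := by gcongr
    _ ≤ (p n)⁻¹ ^ 2 * (p n)⁻¹ := by
        rw [integral_const_mul]
        gcongr
        exact h.integral_hatXi_sq_le hn i j
    _ = (p n)⁻¹ ^ 3 := by ring

/-- The number of edges is `n²`, so that `3 (n² / p)² + n² / p³` bounds the fourth moment of every
bounded linear statistic of the recentred graph. -/
theorem integral_linear_pow_four_le (h : IsErdosRenyi p Pg) {n : ℕ} (hn : 2 ≤ n)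
    {a : Fin n × Fin n → ℝ} (ha : ∀ e, |a e| ≤ 1) :
    ∫ G, (∑ e, a e * hatXi p G n e.1 e.2) ^ 4 ∂Pg ≤
      3 * ((n : ℝ) ^ 2 * (p n)⁻¹) ^ 2 + (n : ℝ) ^ 2 * (p n)⁻¹ ^ 3 := by
  have h0 := h.pos n hn
  have hind : iIndepFun (fun (e : Fin n × Fin n) G => a e * hatXi p G n e.1 e.2) Pg :=
    (h.indep n hn).comp
      (fun e (b : Bool) => a e * ((if b then (1 : ℝ) else 0) / p n - 1))
      (fun _ => measurable_of_countable _)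
  -- Multiplying by `|a e| ≤ 1` does not increase even moments.
  have hpow : ∀ (m : ℕ) (c : ℝ), Even m → (∀ e : Fin n × Fin n,
      ∫ G, hatXi p G n e.1 e.2 ^ m ∂Pg ≤ c) → ∀ e : Fin n × Fin n,
      ∫ G, (a e * hatXi p G n e.1 e.2) ^ m ∂Pg ≤ c := by
    intro m c hm hc e
    simp only [mul_pow]
    rw [integral_const_mul]
    have h1 : a e ^ m ≤ 1 := by
      rw [← hm.pow_abs]
      exact pow_le_one₀ (abs_nonneg _) (ha e)
    exact (mul_le_of_le_one_left (integral_nonneg fun G => hm.pow_nonneg _) h1).trans (hc e)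
  have := integral_sum_pow_four_le (μ := Pg)
    (Y := fun (e : Fin n × Fin n) G => a e * hatXi p G n e.1 e.2) (C := (p n)⁻¹)
    (fun e => (measurable_hatXi p n e.1 e.2).const_mul _)
    (fun e G => by
      rw [abs_mul]
      exact (mul_le_of_le_one_left (abs_nonneg _) (ha e)).trans (h.abs_hatXi_le hn e.1 e.2 G))
    hind (fun e => by rw [integral_const_mul, h.integral_hatXi hn, mul_zero])
    (hpow 2 _ (by decide) fun e => h.integral_hatXi_sq_le hn e.1 e.2)
    (hpow 4 _ (by decide) fun e => h.integral_hatXi_pow_four_le hn e.1 e.2) Finset.univ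
  simpa [Finset.card_univ, ← sq] using this

end IsErdosRenyi

/-! ### Fourier modes of the rescaled measure -/

/-- The Fourier modes of `hatEta`, written as sums over the edges. -/
noncomputable def etaMode (p : ℕ → ℝ) (n : ℕ) (G : GraphSeq) (θ : InitSeq) (k : ℤ × ℤ) : ℂ :=
  ((Real.sqrt n * (1 / (n : ℝ) ^ 2) : ℝ) : ℂ) *
    ∑ e : Fin n × Fin n, (hatXi p G n e.1 e.2 : ℂ) * torusChar k (θ n e.1, θ n e.2)

theorem hasModes_hatEta (r : ℝ) (hr : 1 < r) (p : ℕ → ℝ) (n : ℕ) (G : GraphSeq) (θ : InitSeq) :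
    HasModes (hatEta r hr p n G θ) (etaMode p n G θ) := by
  have h : HasModes (hatEta r hr p n G θ) _ :=
    ((HasModes.sum Finset.univ fun i _ => HasModes.sum Finset.univ fun j _ =>
      (HasModes.dirac (θ n i, θ n j)).const_smul
        (hatXi p G n i j : ℂ)).const_smul ((1 / (n : ℝ) ^ 2 : ℝ) : ℂ)).const_smul
          ((Real.sqrt n : ℝ) : ℂ)
  convert h using 1
  funext k
  rw [etaMode, Fintype.sum_prod_type, Complex.ofReal_mul, mul_assoc]

theorem measurable_etaMode (p : ℕ → ℝ) (n : ℕ) (k : ℤ × ℤ) :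
    Measurable fun x : GraphSeq × InitSeq => etaMode p n x.1 x.2 k := by
  unfold etaMode
  refine (Finset.measurable_fun_sum _ fun e _ => ?_).const_mul _
  have hθ : ∀ i : Fin n, Measurable fun x : GraphSeq × InitSeq => x.2 n i := fun i =>
    (measurable_pi_apply i).comp ((measurable_pi_apply n).comp measurable_snd)
  exact (Complex.measurable_ofReal.comp
    ((measurable_hatXi p n e.1 e.2).comp measurable_fst)).mul
    ((continuous_torusChar k).measurable.comp ((hθ e.1).prodMk (hθ e.2)))

theorem measurable_hatEta (r : ℝ) (hr : 1 < r) (p : ℕ → ℝ) (n : ℕ) (G : GraphSeq) :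
    Measurable (hatEta r hr p n G) := by
  have hc : Continuous fun x : Fin n → Torus => ((Real.sqrt n : ℝ) : ℂ) •
      (((1 / (n : ℝ) ^ 2 : ℝ) : ℂ) • ∑ i : Fin n, ∑ j : Fin n,
        ((hatXi p G n i j : ℝ) : ℂ) • diracMass r hr (x i, x j)) := by
    have := continuous_diracMass r hr
    fun_prop
  exact hc.measurable.comp (measurable_pi_apply n)

/-- The bound `4 (3 / (n² p²) + 1 / (n⁴ p³))` for the fourth moment of a Fourier mode. The value at
`n < 2` is a placeholder, since nothing is assumed about `p 0` and `p 1`. -/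
noncomputable def modeBound (p : ℕ → ℝ) (n : ℕ) : ℝ :=
  if 2 ≤ n then 4 * (3 * ((n : ℝ) ^ 2 * p n ^ 2)⁻¹ + ((n : ℝ) ^ 4 * p n ^ 3)⁻¹) else 0

/-- The initial condition is frozen, so that the real and the imaginary part of a mode are linear
statistics of the graph with coefficients in `[-1, 1]`; the prefactor contributes `n⁻⁶`. -/
theorem lintegral_etaMode_le {p : ℕ → ℝ} {Pg : Measure GraphSeq} [IsProbabilityMeasure Pg]
    (h : IsErdosRenyi p Pg) {n : ℕ} (hn : 2 ≤ n) (θ : InitSeq) (k : ℤ × ℤ) :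
    ∫⁻ G, ‖etaMode p n G θ k‖ₑ ^ 4 ∂Pg ≤ ENNReal.ofReal (modeBound p n) := by
  have h0 := h.pos n hn
  have hn0 : (0 : ℝ) < n := by positivity
  let c : Fin n × Fin n → ℂ := fun e => torusChar k (θ n e.1, θ n e.2)
  have hre : ∀ e, |(c e).re| ≤ 1 := fun e =>
    (Complex.abs_re_le_norm _).trans (norm_torusChar _ _).le
  have him : ∀ e, |(c e).im| ≤ 1 := fun e =>
    (Complex.abs_im_le_norm _).trans (norm_torusChar _ _).le
  have hint : ∀ a : Fin n × Fin n → ℝ, (∀ e, |a e| ≤ 1) →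
      Integrable (fun G => (∑ e, a e * hatXi p G n e.1 e.2) ^ 4) Pg := fun a ha => by
    refine Integrable.of_bound (Measurable.aestronglyMeasurable ?_)
      ((∑ _e : Fin n × Fin n, (p n)⁻¹) ^ 4) (Eventually.of_forall fun G => ?_)
    · exact (Finset.measurable_fun_sum _ fun e _ =>
        (measurable_hatXi p n e.1 e.2).const_mul _).pow_const 4
    · rw [norm_pow]
      gcongr
      refine (norm_sum_le _ _).trans (Finset.sum_le_sum fun e _ => ?_)
      rw [norm_mul]
      exact (mul_le_of_le_one_left (norm_nonneg _) (ha e)).trans (h.abs_hatXi_le hn _ _ G)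
  set B : ℝ := 3 * ((n : ℝ) ^ 2 * (p n)⁻¹) ^ 2 + (n : ℝ) ^ 2 * (p n)⁻¹ ^ 3 with hB
  set s : ℝ := Real.sqrt n * (1 / (n : ℝ) ^ 2) with hs
  have hs4 : s ^ 4 = ((n : ℝ) ^ 6)⁻¹ := by
    have : Real.sqrt n ^ 4 = (n : ℝ) ^ 2 := by
      rw [show 4 = 2 * 2 from rfl, pow_mul, Real.sq_sqrt hn0.le]
    rw [hs, mul_pow, this]
    field_simp
  have hpt : ∀ G, ‖etaMode p n G θ k‖ ^ 4 ≤ s ^ 4 * 2 *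
      ((∑ e, (c e).re * hatXi p G n e.1 e.2) ^ 4 +
        (∑ e, (c e).im * hatXi p G n e.1 e.2) ^ 4) := by
    intro G
    set z : ℂ := ∑ e : Fin n × Fin n, (hatXi p G n e.1 e.2 : ℂ) * c e with hz
    have e1 : ∑ e, (c e).re * hatXi p G n e.1 e.2 = z.re := by
      rw [hz, Complex.re_sum]
      simp [mul_comm]
    have e2 : ∑ e, (c e).im * hatXi p G n e.1 e.2 = z.im := by
      rw [hz, Complex.im_sum]
      simp [mul_comm]
    have e3 : etaMode p n G θ k = (s : ℂ) * z := rfl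
    have e4 : ‖z‖ ^ 4 = (z.re ^ 2 + z.im ^ 2) ^ 2 := by
      rw [show 4 = 2 * 2 from rfl, pow_mul, Complex.sq_norm, Complex.normSq_apply]
      ring
    rw [e1, e2, e3, norm_mul, mul_pow, Complex.norm_real, Real.norm_eq_abs,
      Even.pow_abs (by decide), mul_assoc, e4]
    gcongr
    nlinarith [sq_nonneg (z.re ^ 2 - z.im ^ 2)]
  have hlim : ∀ G, ‖etaMode p n G θ k‖ₑ ^ 4 = ENNReal.ofReal (‖etaMode p n G θ k‖ ^ 4) :=
    fun G => by rw [← ofReal_norm, ENNReal.ofReal_pow (norm_nonneg _)]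
  simp only [hlim]
  refine (lintegral_mono fun G => ENNReal.ofReal_le_ofReal (hpt G)).trans ?_
  rw [← ofReal_integral_eq_lintegral_ofReal
    (((hint _ hre).fun_add (hint _ him)).const_mul _)
    (Eventually.of_forall fun G => by
      have := Even.pow_nonneg (by decide : Even 4) (∑ e, (c e).re * hatXi p G n e.1 e.2)
      have := Even.pow_nonneg (by decide : Even 4) (∑ e, (c e).im * hatXi p G n e.1 e.2)
      have := Even.pow_nonneg (by decide : Even 4) s
      simp only [Pi.zero_apply]
      positivity)]
  refine ENNReal.ofReal_le_ofReal ?_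
  rw [integral_const_mul, integral_add (hint _ hre) (hint _ him)]
  have hsum := add_le_add (h.integral_linear_pow_four_le hn hre)
    (h.integral_linear_pow_four_le hn him)
  refine (mul_le_mul_of_nonneg_left hsum (by positivity)).trans (le_of_eq ?_)
  rw [hs4, modeBound, if_pos hn]
  field_simp
  ring

/-- This is where the density assumption enters, only through `p³ n ≥ 1` for large `n`. -/
theorem summable_modeBound {p : ℕ → ℝ} (hp0 : ∀ n, 2 ≤ n → 0 < p n) {ε : ℝ} (hε : 0 < ε)
    (hp : liminf (fun n : ℕ => ((p n ^ 3 * (n : ℝ) ^ (1 - ε) : ℝ) : EReal)) atTop = ⊤) :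
    Summable (modeBound p) := by
  have hev : ∀ᶠ n : ℕ in atTop, ((1 : ℝ) : EReal) <
      ((p n ^ 3 * (n : ℝ) ^ (1 - ε) : ℝ) : EReal) :=
    eventually_lt_of_lt_liminf (by rw [hp]; exact EReal.coe_lt_top 1)
  have hsum : Summable fun n : ℕ => 16 * (n : ℝ) ^ (-(4 / 3) : ℝ) :=
    (Real.summable_nat_rpow.2 (by norm_num)).mul_left 16
  refine hsum.of_norm_bounded_eventually_nat ?_
  filter_upwards [hev, eventually_ge_atTop 2] with n h1 hn
  have hpn := hp0 n hn
  have hn1 : (1 : ℝ) ≤ n := by exact_mod_cast (by lia : 1 ≤ n)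
  have hn0 : (0 : ℝ) < n := by linarith
  -- `p ≥ n^{-1/3}` is all that is needed: the two terms are then of order `n^{-4/3}` and `n^{-3}`.
  have hp3 : 1 ≤ p n ^ 3 * n := by
    have h2 : 1 < p n ^ 3 * (n : ℝ) ^ (1 - ε) := EReal.coe_lt_coe_iff.1 h1
    have h3 : (n : ℝ) ^ (1 - ε) ≤ (n : ℝ) ^ (1 : ℝ) :=
      Real.rpow_le_rpow_of_exponent_le hn1 (by linarith)
    rw [Real.rpow_one] at h3
    exact h2.le.trans (mul_le_mul_of_nonneg_left h3 (by positivity))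
  have hp1 : (n : ℝ) ^ (-(1 / 3) : ℝ) ≤ p n := by
    refine le_of_pow_le_pow_left₀ three_ne_zero hpn.le ?_
    rw [← Real.rpow_natCast, ← Real.rpow_mul hn0.le]
    norm_num
    rw [Real.rpow_neg_one]
    exact (inv_le_iff_one_le_mul₀ hn0).2 hp3
  have hA : ((n : ℝ) ^ 2 * p n ^ 2)⁻¹ ≤ (n : ℝ) ^ (-(4 / 3) : ℝ) := by
    rw [show (-(4 / 3) : ℝ) = -(2 + (-(1 / 3)) * 2) by norm_num, Real.rpow_neg hn0.le,
      Real.rpow_add hn0, Real.rpow_mul hn0.le, Real.rpow_two, Real.rpow_two]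
    gcongr
  have hB : ((n : ℝ) ^ 4 * p n ^ 3)⁻¹ ≤ (n : ℝ) ^ (-(4 / 3) : ℝ) := by
    rw [Real.rpow_neg hn0.le]
    refine inv_anti₀ (by positivity) ?_
    calc (n : ℝ) ^ (4 / 3 : ℝ) ≤ (n : ℝ) ^ (3 : ℝ) :=
          Real.rpow_le_rpow_of_exponent_le hn1 (by norm_num)
      _ = (n : ℝ) ^ 3 := by rw [← Real.rpow_natCast]; norm_num
      _ ≤ (n : ℝ) ^ 3 * (p n ^ 3 * n) := le_mul_of_one_le_right (by positivity) hp3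
      _ = _ := by ring
  rw [modeBound, if_pos hn, Real.norm_of_nonneg (by positivity)]
  linarith

/-! ### Almost sure summability over the sizes of the graphs -/

/-- The weighted fourth moment `∑ (1 + |k|²)^{-r} |η̂(k)|⁴` of the Fourier modes of `hatEta`. -/
noncomputable def quarticForm (r : ℝ) (p : ℕ → ℝ) (n : ℕ) (G : GraphSeq) (θ : InitSeq) : ℝ≥0∞ :=
  ∑' k, ENNReal.ofReal (japSq k ^ (-r)) * ‖etaMode p n G θ k‖ₑ ^ 4

theorem measurable_quarticForm (r : ℝ) (p : ℕ → ℝ) (n : ℕ) :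
    Measurable (Function.uncurry (quarticForm r p n)) :=
  Measurable.tsum fun k =>
    ((measurable_etaMode p n k).enorm.pow_const 4).const_mul _

/-- By Tonelli's theorem the graph can be averaged first, with the initial condition frozen. The
series over `n` has a finite mean, and this makes the dependence between the graphs of different
sizes irrelevant. -/
theorem ae_tsum_lintegral_quarticForm_lt_top {r : ℝ} (hr : 1 < r) {p : ℕ → ℝ}
    {Pg : Measure GraphSeq} [IsProbabilityMeasure Pg] {P₀ : Measure InitSeq}
    [IsProbabilityMeasure P₀] (h : IsErdosRenyi p Pg) (hs : Summable (modeBound p)) :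
    ∀ᵐ G ∂Pg, ∑' n : ℕ, ∫⁻ θ, quarticForm r p (n + 2) G θ ∂P₀ < ∞ := by
  have hw : ∀ k, 0 ≤ japSq k ^ (-r) := fun k => Real.rpow_nonneg (japSq_pos k).le _
  set W : ℝ≥0∞ := ∑' k, ENNReal.ofReal (japSq k ^ (-r)) with hW
  have hWfin : W ≠ ∞ := by
    rw [hW, ← ENNReal.ofReal_tsum_of_nonneg hw (summable_japSq_rpow_neg hr)]
    exact ENNReal.ofReal_ne_top
  have hG : ∀ n θ, ∫⁻ G, quarticForm r p (n + 2) G θ ∂Pg ≤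
      W * ENNReal.ofReal (modeBound p (n + 2)) := by
    intro n θ
    have hm : ∀ k, Measurable fun G => ‖etaMode p (n + 2) G θ k‖ₑ ^ 4 := fun k =>
      ((measurable_etaMode p (n + 2) k).comp
        (measurable_prodMk_right (y := θ))).enorm.pow_const 4
    unfold quarticForm
    rw [lintegral_tsum fun k => ((hm k).const_mul _).aemeasurable, hW, ← ENNReal.tsum_mul_right]
    refine ENNReal.tsum_le_tsum fun k => ?_
    rw [lintegral_const_mul _ (hm k)]
    gcongr
    exact lintegral_etaMode_le h (by lia) θ k
  have hmeas : ∀ n, Measurable fun G => ∫⁻ θ, quarticForm r p n G θ ∂P₀ := fun n =>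
    (measurable_quarticForm r p n).lintegral_prod_right
  refine ae_lt_top (Measurable.tsum fun n => hmeas (n + 2)) (ne_of_lt ?_)
  rw [lintegral_tsum fun n => (hmeas (n + 2)).aemeasurable]
  calc ∑' n, ∫⁻ G, ∫⁻ θ, quarticForm r p (n + 2) G θ ∂P₀ ∂Pg
      ≤ ∑' n, W * ENNReal.ofReal (modeBound p (n + 2)) := by
        refine ENNReal.tsum_le_tsum fun n => ?_
        rw [lintegral_lintegral_swap (measurable_quarticForm r p (n + 2)).aemeasurable]
        refine (lintegral_mono fun θ => hG n θ).trans ?_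
        simp
    _ < ∞ := by
        rw [ENNReal.tsum_mul_left]
        exact ENNReal.mul_lt_top hWfin.lt_top
          ((summable_nat_add_iff 2).2 hs).tsum_ofReal_lt_top

theorem lintegral_enorm_hatEta_sq_le (r : ℝ) (hr : 1 < r) (p : ℕ → ℝ) (n : ℕ) (G : GraphSeq)
    (P₀ : Measure InitSeq) [IsProbabilityMeasure P₀] {δ : ℝ} (hδ : 0 < δ) :
    ∫⁻ θ, ‖hatEta r hr p n G θ‖ₑ ^ 2 ∂P₀ ≤ ENNReal.ofReal (δ * ∑' k, japSq k ^ (-r)) +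
      ENNReal.ofReal δ⁻¹ * ∫⁻ θ, quarticForm r p n G θ ∂P₀ := by
  have hm : Measurable fun θ => quarticForm r p n G θ :=
    (measurable_quarticForm r p n).of_uncurry_left
  have hpt : ∀ θ, ‖hatEta r hr p n G θ‖ₑ ^ 2 ≤ ENNReal.ofReal (δ * ∑' k, japSq k ^ (-r)) +
      ENNReal.ofReal δ⁻¹ * quarticForm r p n G θ := fun θ => by
    have h := (hasModes_hatEta r hr p n G θ).enorm_sq_le hδ
    rwa [← quarticForm] at h
  refine (lintegral_mono hpt).trans (le_of_eq ?_)
  rw [lintegral_add_left measurable_const, lintegral_const, measure_univ, mul_one,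
    lintegral_const_mul _ hm]

/-! ### Limits under the law of the initial conditions -/

theorem tendsto_lintegral_enorm_hatEta_sq {r : ℝ} {hr : 1 < r} {p : ℕ → ℝ} {G : GraphSeq}
    {P₀ : Measure InitSeq} [IsProbabilityMeasure P₀]
    (h : ∑' n : ℕ, ∫⁻ θ, quarticForm r p (n + 2) G θ ∂P₀ < ∞) :
    Tendsto (fun n : ℕ => ∫⁻ θ, ‖hatEta r hr p n G θ‖ₑ ^ 2 ∂P₀) atTop (𝓝 0) := by
  have h0 : Tendsto (fun n : ℕ => ∫⁻ θ, quarticForm r p n G θ ∂P₀) atTop (𝓝 0) :=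
    (tendsto_add_atTop_iff_nat 2).1 (ENNReal.tendsto_atTop_zero_of_tsum_ne_top h.ne)
  have hW : 0 ≤ ∑' k, japSq k ^ (-r) :=
    tsum_nonneg fun k => Real.rpow_nonneg (japSq_pos k).le _
  set W : ℝ := ∑' k, japSq k ^ (-r)
  rw [ENNReal.tendsto_nhds_zero]
  intro η hη
  obtain ⟨γ, hγ0, hγ⟩ : ∃ γ : ℝ, 0 < γ ∧ ENNReal.ofReal γ < η := by
    obtain ⟨γ, -, hγ0, hγ⟩ := ENNReal.lt_iff_exists_real_btwn.1 hη
    exact ⟨γ, ENNReal.ofReal_pos.1 hγ0, hγ⟩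
  -- With this `δ` the constant term is at most `γ / 2`; `W + 1` avoids a division by zero.
  set δ : ℝ := γ / 2 / (W + 1) with hδ'
  have hδ : 0 < δ := by positivity
  have h1 : Tendsto (fun n : ℕ => ENNReal.ofReal δ⁻¹ * ∫⁻ θ, quarticForm r p n G θ ∂P₀) atTop
      (𝓝 0) := by
    simpa using ENNReal.Tendsto.const_mul h0 (Or.inr ENNReal.ofReal_ne_top)
  have h2 := ENNReal.tendsto_nhds_zero.1 h1 (ENNReal.ofReal (γ / 2))
    (ENNReal.ofReal_pos.2 (by positivity))
  filter_upwards [h2] with n hn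
  refine (lintegral_enorm_hatEta_sq_le r hr p n G P₀ hδ).trans (le_trans ?_ hγ.le)
  have h3 : δ * W ≤ γ / 2 := by
    rw [hδ', div_mul_eq_mul_div, div_le_iff₀ (by positivity)]
    nlinarith
  calc _ ≤ ENNReal.ofReal (γ / 2) + ENNReal.ofReal (γ / 2) :=
        add_le_add (ENNReal.ofReal_le_ofReal h3) hn
    _ = ENNReal.ofReal γ := by
        rw [← ENNReal.ofReal_add (by positivity) (by positivity), add_halves]

theorem iSup_lintegral_enorm_hatEta_rpow_lt_top {r : ℝ} {hr : 1 < r} {p : ℕ → ℝ} {G : GraphSeq}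
    {P₀ : Measure InitSeq} [IsProbabilityMeasure P₀]
    (h : ∑' n : ℕ, ∫⁻ θ, quarticForm r p (n + 2) G θ ∂P₀ < ∞) {s : ℝ} (hs0 : 0 ≤ s)
    (hs : s ≤ 2) :
    (⨆ (n : ℕ) (_ : 2 ≤ n), ∫⁻ θ, ‖hatEta r hr p n G θ‖ₑ ^ s ∂P₀) < ∞ := by
  set W : ℝ := ∑' k, japSq k ^ (-r)
  refine lt_of_le_of_lt (b := 1 + (ENNReal.ofReal (1 * W) + ENNReal.ofReal 1⁻¹ *
    ∑' n : ℕ, ∫⁻ θ, quarticForm r p (n + 2) G θ ∂P₀)) (iSup₂_le fun n hn => ?_) ?_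
  · obtain ⟨m, rfl⟩ := Nat.exists_eq_add_of_le' hn
    have hpt : ∀ x : ℝ≥0∞, x ^ s ≤ 1 + x ^ 2 := fun x => by
      rcases le_total x 1 with hx | hx
      · exact (ENNReal.rpow_le_one hx hs0).trans le_self_add
      · refine le_trans ?_ le_add_self
        rw [← ENNReal.rpow_two]
        exact ENNReal.rpow_le_rpow_of_exponent_le hx hs
    refine (lintegral_mono fun θ => hpt _).trans ?_
    rw [lintegral_add_left measurable_const, lintegral_const, measure_univ, mul_one]
    gcongr
    refine (lintegral_enorm_hatEta_sq_le r hr p (m + 2) G P₀ one_pos).trans ?_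
    gcongr
    exact ENNReal.le_tsum m
  · exact ENNReal.add_lt_top.2 ⟨ENNReal.one_lt_top, ENNReal.add_lt_top.2
      ⟨ENNReal.ofReal_lt_top, ENNReal.mul_lt_top ENNReal.ofReal_lt_top h⟩⟩

/-- Chebyshev's inequality gives convergence in probability, hence in law. -/
theorem tendstoInDistribution_hatEta {r : ℝ} {hr : 1 < r} {p : ℕ → ℝ} {G : GraphSeq}
    {P₀ : Measure InitSeq} [IsProbabilityMeasure P₀]
    (h : Tendsto (fun n : ℕ => ∫⁻ θ, ‖hatEta r hr p n G θ‖ₑ ^ 2 ∂P₀) atTop (𝓝 0)) :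
    TendstoInDistribution (fun n : ℕ => hatEta r hr p n G) atTop
      (fun _ : InitSeq => (0 : NegSobolev r hr)) (fun _ => P₀) P₀ := by
  refine TendstoInMeasure.tendstoInDistribution (fun η hη => ?_)
    fun n => (measurable_hatEta r hr p n G).aemeasurable
  simp only [edist_zero_right]
  rcases eq_or_ne η ∞ with rfl | hη'
  · simp
  have hη2 : η ^ 2 ≠ 0 := pow_ne_zero 2 hη.ne'
  have hη2' : η ^ 2 ≠ ∞ := ENNReal.pow_ne_top hη'
  have hlim : Tendsto (fun n : ℕ => (∫⁻ θ, ‖hatEta r hr p n G θ‖ₑ ^ 2 ∂P₀) / η ^ 2) atTop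
      (𝓝 0) := by
    simpa using ENNReal.Tendsto.div_const h (Or.inr hη2)
  refine tendsto_of_tendsto_of_tendsto_of_le_of_le tendsto_const_nhds hlim
    (fun n => zero_le) fun n => ?_
  refine (measure_mono fun θ (hθ : η ≤ _) => ?_).trans
    (meas_ge_le_lintegral_div ((measurable_hatEta r hr p n G).enorm.pow_const 2).aemeasurable
      hη2 hη2')
  exact pow_le_pow_left' hθ 2

theorem mainTheorem5 (p : ℕ → ℝ) (P : Measure (GraphSeq × InitSeq)) [IsProbabilityMeasure P]
    (hER : IsErdosRenyi p P.fst)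
    (hindep : P = P.fst.prod P.snd)
    (ε : ℝ) (hε0 : 0 < ε) (hε1 : ε < 1)
    (hp : liminf (fun n : ℕ => ((p n ^ 3 * (n : ℝ) ^ (1 - ε) : ℝ) : EReal)) atTop = ⊤) :
    (∀ (r : ℝ) (hr : 1 < r), ∀ᵐ G ∂P.fst,
      Tendsto (fun n : ℕ => ∫⁻ θ, ‖hatEta r hr p n G θ‖ₑ ^ 2 ∂(quenchedLaw P G))
        atTop (𝓝 0)) ∧
    (∀ (r₀ : ℝ) (hr₀ : 3 < r₀) (α : ℝ), 0 < α → α < 1 → ∀ᵐ G ∂P.fst,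
      (⨆ (n : ℕ) (_ : 2 ≤ n),
        ∫⁻ θ, ‖hatEta r₀ (by linarith) p n G θ‖ₑ ^ (1 + α) ∂(quenchedLaw P G)) < ∞) ∧
    (∀ (r₁ : ℝ) (hr₁ : 5 < r₁), ∀ᵐ G ∂P.fst,
      TendstoInDistribution (fun n : ℕ => hatEta r₁ (by linarith) p n G) atTop
        (fun _ : InitSeq => (0 : NegSobolev r₁ (by linarith)))
        (fun _ => quenchedLaw P G) (quenchedLaw P G)) := by
  have key : ∀ r : ℝ, 1 < r → ∀ᵐ G ∂P.fst,
      ∑' n : ℕ, ∫⁻ θ, quarticForm r p (n + 2) G θ ∂(quenchedLaw P G) < ∞ := by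
    intro r hr
    filter_upwards [quenchedLaw_eq_snd P hindep, ae_tsum_lintegral_quarticForm_lt_top hr
      (P₀ := P.snd) hER (summable_modeBound hER.pos hε0 hp)] with G hG h
    rwa [hG]
  refine ⟨fun r hr => ?_, fun r₀ hr₀ α hα0 hα1 => ?_, fun r₁ hr₁ => ?_⟩
  · filter_upwards [key r hr] with G h
    exact tendsto_lintegral_enorm_hatEta_sq h
  · filter_upwards [key r₀ (by linarith)] with G h
    exact iSup_lintegral_enorm_hatEta_rpow_lt_top h (by linarith) (by linarith)
  · filter_upwards [key r₁ (by linarith)] with G h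
    exact tendstoInDistribution_hatEta (tendsto_lintegral_enorm_hatEta_sq h)
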